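/- Theorem. For integers $n\ge 2$ and $a,b\ge 1$, consider the $(a:b)$ Maker-Breaker connectivity game on the edge set of $K_n$: in each round Breaker first claims $b$ free edges and then Maker claims $a$ free edges (a player who finds fewer free edges than his bias claims all of them), and Maker wins if and only if the edges he has claimed by the end of the game form a connected spanning subgraph of $K_n$. The threshold bias $b_0=b_0(n,a)$ is the positive integer such that Maker has a winning strategy for every $1\le b<b_0$ and Breaker has a winning strategy for every $b\ge b_0$. Let $a=a(n)$ be a sequence of non-negative integers with $a(n)\ge 1$ for all large $n$, and let asymptotics refer to $n\to\infty$. (i) If $a=o\big(\sqrt{n/\ln n}\big)$, then for all large $n$ the threshold bias $b_0(n,a(n))$ exists, and $b_0(n,a(n))=(1+o(1))\,\frac{an}{a+\ln n}$. (ii) If $a=\Omega\big(\sqrt{n/\ln n}\big)$, then for all large $n$ the threshold bias $b_0(n,a(n))$ exists, and $b_0(n,a(n))=(1+o(1))\,n$. (iii) In particular, if $a=(1+o(1))\,c\ln n$ for a constant $c>0$, then for all large $n$ the threshold bias exists, and $b_0(n,a(n))=(1+o(1))\,\frac{cn}{c+1}$. -/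

import Mathlib

open Filter Asymptotics

/-! ### Biased Maker-Breaker games on a hypergraph

The board is a finite set `X`, the winning sets form a family `F` of finite sets.  In every round
Breaker moves first and claims `b` free elements, then Maker claims `a` free elements; a player who
finds fewer free elements than his bias claims all of them.  A play is a pair of sequences
`S, T : ℕ → Finset E`, where `S i` and `T i` are the sets claimed by Breaker and by Maker in
round `i` (rounds are counted from `0`; once the board is exhausted all moves are empty). -/

section MakerBreaker

variable {E : Type*} [DecidableEq E]

/-- The elements claimed by a player with move sequence `S` in the rounds before round `i`. -/
def claimed (S : ℕ → Finset E) (i : ℕ) : Finset E :=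
  (Finset.range i).biUnion S

/-- `U` is a legal move of a player with bias `k` when `free` is the set of free elements. -/
def IsLegalMove (k : ℕ) (free U : Finset E) : Prop :=
  U ⊆ free ∧ U.card = min k free.card

/-- Breaker's move in round `i` is legal. -/
def BreakerLegal (X : Finset E) (b : ℕ) (S T : ℕ → Finset E) (i : ℕ) : Prop :=
  IsLegalMove b (X \ (claimed S i ∪ claimed T i)) (S i)

/-- Maker's move in round `i`, which comes after Breaker's move in round `i`, is legal. -/
def MakerLegal (X : Finset E) (a : ℕ) (S T : ℕ → Finset E) (i : ℕ) : Prop :=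
  IsLegalMove a (X \ (claimed S (i + 1) ∪ claimed T i)) (T i)

/-- Maker, with move sequence `T`, eventually occupies all elements of some winning set. -/
def MakerOccupies (F : Set (Finset E)) (T : ℕ → Finset E) : Prop :=
  ∃ W ∈ F, ∃ N, W ⊆ claimed T N

/-- The first `i` moves `S 0, …, S (i - 1)` of a player. -/
def history (S : ℕ → Finset E) (i : ℕ) : List (Finset E) :=
  (List.range i).map S

/-- Maker has a winning strategy in the `(a : b)` game `(X, F)`.  A strategy `σ` maps the list of
all moves that Breaker has made so far to Maker's next move.  It must answer legal play by legal
moves, and win against every legal play of Breaker. -/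
def MakerHasWinningStrategy (X : Finset E) (F : Set (Finset E)) (a b : ℕ) : Prop :=
  ∃ σ : List (Finset E) → Finset E, ∀ S T : ℕ → Finset E,
    (∀ i, T i = σ (history S (i + 1))) →
      (∀ i, (∀ j ≤ i, BreakerLegal X b S T j) → MakerLegal X a S T i) ∧
      ((∀ i, BreakerLegal X b S T i) → MakerOccupies F T)

/-- Breaker has a winning strategy in the `(a : b)` game `(X, F)`.  A strategy `τ` maps the list of
all moves that Maker has made so far to Breaker's next move.  It must answer legal play by legal
moves, and prevent Maker from occupying a winning set in every legal play of Maker. -/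
def BreakerHasWinningStrategy (X : Finset E) (F : Set (Finset E)) (a b : ℕ) : Prop :=
  ∃ τ : List (Finset E) → Finset E, ∀ S T : ℕ → Finset E,
    (∀ i, S i = τ (history T i)) →
      (∀ i, (∀ j < i, MakerLegal X a S T j) → BreakerLegal X b S T i) ∧
      ((∀ i, MakerLegal X a S T i) → ¬ MakerOccupies F T)

/-- `b₀` is the threshold bias of the game `(X, F)` for Maker's bias `a`: a positive integer such
that Maker has a winning strategy for every Breaker bias `b < b₀`, and Breaker has one for every
`b ≥ b₀` (biases are positive integers). -/
def IsThresholdBias (X : Finset E) (F : Set (Finset E)) (a b₀ : ℕ) : Prop :=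
  1 ≤ b₀ ∧
    (∀ b, 1 ≤ b → b < b₀ → MakerHasWinningStrategy X F a b) ∧
    (∀ b, b₀ ≤ b → BreakerHasWinningStrategy X F a b)

end MakerBreaker

/-! ### The connectivity game on the complete graph -/

/-- The board: the edges of the complete graph on `n` vertices. -/
def completeBoard (n : ℕ) : Finset (Sym2 (Fin n)) :=
  (⊤ : SimpleGraph (Fin n)).edgeFinset

/-- The winning sets: the edge sets of connected spanning subgraphs of the complete graph. -/
def connectedSpanningSets (n : ℕ) : Set (Finset (Sym2 (Fin n))) :=
  {W | W ⊆ completeBoard n ∧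
    (SimpleGraph.fromEdgeSet (W : Set (Sym2 (Fin n)))).Connected}

/-- For Maker's bias `a = a(n)`, the asymptotic threshold bias of the connectivity game is `f(n)`:
for all large `n` the threshold bias `b₀(n)` exists, and `b₀(n) = (1 + o(1)) f(n)`. -/
def IsAsymptoticConnectivityBias (a : ℕ → ℕ) (f : ℕ → ℝ) : Prop :=
  ∃ b₀ : ℕ → ℕ,
    (∀ᶠ n in atTop,
      IsThresholdBias (completeBoard n) (connectedSpanningSets n) (a n) (b₀ n)) ∧
    (fun n => (b₀ n : ℝ)) ~[atTop] f

/-! ### Determinacy and bias monotonicity for finite Maker-Breaker games. -/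

section PositionalGame

/-! All three parts follow from one estimate, valid for every `a ≥ 1`: the threshold is `(1 + o(1))
an / (a + ln n)`. The game is finite, hence determined, and extra bias never hurts Breaker. So a
threshold exists once Breaker wins for some bias, and it remains to decide who wins just below and
just above `an / (a + ln n)`.

Maker's side (`makerWinsFrom_of_reachCover`). Maker keeps a set `A` of active vertices such that
every vertex is connected to `A` in his graph, and in each round deactivates the `a` active vertices
of largest danger, spending at most one edge on each. One active vertex left means connected. Danger
is essentially the Breaker degree into light vertices, so an edge raises the danger of at most one
endpoint, and a round adds at most `b` in total. With exponent `a / b` the exponential potential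
over `A` does not increase, so active dangers stay below `m + (b / a) ln n` before Breaker's move.
Adding his next `b` edges and the few heavy vertices still leaves the Breaker degree below `n` by
more than the smaller side of any cut he could own. Hence a needed edge is always free.

Breaker's side (`not_makerWinsFrom_of_growing`). Breaker builds a clique of vertices untouched by
Maker, then plays the box game on their stars: he spreads his edges evenly while each Maker edge
kills at most one star. A surviving star receives about `∑ b / (1 + ia)`, roughly `b + (b / a) ln
n`, edges, enough to isolate its centre when `b` exceeds `(1 + δ) an / (a + ln n)`. -/

theorem IsLegalMove.exists_superset {E : Type*} {k : ℕ} {free U : Finset E} (hU : U ⊆ free)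
    (hk : U.card ≤ k) : ∃ V, U ⊆ V ∧ IsLegalMove k free V := by
  obtain ⟨V, h1, h2, h3⟩ := Finset.exists_subsuperset_card_eq hU
    (le_min hk (Finset.card_le_card hU)) (min_le_right k free.card)
  exact ⟨V, h1, h2, h3⟩

theorem IsLegalMove.exists {E : Type*} (k : ℕ) (free : Finset E) : ∃ V, IsLegalMove k free V := by
  obtain ⟨V, -, h⟩ := IsLegalMove.exists_superset (k := k) (Finset.empty_subset free) (by simp)
  exact ⟨V, h⟩

theorem history_succ {E : Type*} (S : ℕ → Finset E) (i : ℕ) : history S (i + 1) = history S i ++ [S i] := by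
  simp [history, List.range_succ]

variable {E : Type*} [DecidableEq E]

/-- Maker can force a win from the position in which Breaker has claimed `B`, Maker has claimed `M`
and Breaker is about to move. -/
inductive MakerWinsFrom (X : Finset E) (F : Set (Finset E)) (a b : ℕ) :
    Finset E → Finset E → Prop
  | occupied {B M W : Finset E} : W ∈ F → W ⊆ M → MakerWinsFrom X F a b B M
  | round {B M : Finset E} (R : Finset E → Finset E)
      (hR : ∀ S, IsLegalMove b (X \ (B ∪ M)) S → IsLegalMove a (X \ (B ∪ S ∪ M)) (R S))
      (h : ∀ S, IsLegalMove b (X \ (B ∪ M)) S → MakerWinsFrom X F a b (B ∪ S) (M ∪ R S)) :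
      MakerWinsFrom X F a b B M

theorem claimed_zero (S : ℕ → Finset E) : claimed S 0 = ∅ := by simp [claimed]

theorem claimed_succ (S : ℕ → Finset E) (i : ℕ) : claimed S (i + 1) = claimed S i ∪ S i := by
  simp [claimed, Finset.range_add_one, Finset.union_comm]

variable {X : Finset E} {F : Set (Finset E)} {a b : ℕ}

theorem MakerWinsFrom.exists_reply {B M S : Finset E} (h : MakerWinsFrom X F a b B M)
    (hS : IsLegalMove b (X \ (B ∪ M)) S) :
    ∃ T, IsLegalMove a (X \ (B ∪ S ∪ M)) T ∧ MakerWinsFrom X F a b (B ∪ S) (M ∪ T) := by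
  cases h with
  | occupied hW hWM =>
    obtain ⟨T, hT⟩ := IsLegalMove.exists a (X \ (B ∪ S ∪ M))
    exact ⟨T, hT, .occupied hW (hWM.trans Finset.subset_union_left)⟩
  | round R hR h => exact ⟨R S, hR S hS, h S hS⟩

theorem MakerWinsFrom.of_replies {B M : Finset E}
    (h : ∀ S, IsLegalMove b (X \ (B ∪ M)) S →
      ∃ T, IsLegalMove a (X \ (B ∪ S ∪ M)) T ∧ MakerWinsFrom X F a b (B ∪ S) (M ∪ T)) :
    MakerWinsFrom X F a b B M := by
  choose! R hR using h
  exact .round R (fun S hS => (hR S hS).1) fun S hS => (hR S hS).2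

theorem MakerWinsFrom.occupied_of_exhausted {B M : Finset E} (h : MakerWinsFrom X F a b B M) :
    X \ (B ∪ M) = ∅ → ∃ W ∈ F, W ⊆ M := by
  induction h with
  | occupied hW hWM => exact fun _ => ⟨_, hW, hWM⟩
  | @round B M R hR h ih =>
    intro hX
    have hS : IsLegalMove b (X \ (B ∪ M)) ∅ := by simp [IsLegalMove, hX]
    have hT := (hR ∅ hS).1
    rw [Finset.union_empty, hX, Finset.subset_empty] at hT
    have := ih ∅ hS
    rw [hT, Finset.union_empty, Finset.union_empty] at this
    exact this hX

theorem card_free_le (hb : 1 ≤ b) {S T : ℕ → Finset E} (h : ∀ i, BreakerLegal X b S T i) (i : ℕ) :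
    (X \ (claimed S i ∪ claimed T i)).card ≤ X.card - i := by
  induction i with
  | zero => simp [claimed_zero]
  | succ i ih =>
    obtain ⟨h1, h2⟩ := h i
    have h3 : X \ (claimed S (i + 1) ∪ claimed T (i + 1)) ⊆
        (X \ (claimed S i ∪ claimed T i)) \ S i := by
      intro e
      simp only [claimed_succ, Finset.mem_sdiff, Finset.mem_union]
      tauto
    have h4 := Finset.card_le_card h3
    rw [Finset.card_sdiff_of_subset h1] at h4
    omega

theorem MakerWinsFrom.makerHasWinningStrategy (hb : 1 ≤ b) (h : MakerWinsFrom X F a b ∅ ∅) :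
    MakerHasWinningStrategy X F a b := by
  -- The reply is legal in every position, winning or not, so legality of the strategy needs no
  -- invariant.
  have hR : ∀ B M S : Finset E, ∃ T, IsLegalMove a (X \ (B ∪ S ∪ M)) T ∧
      (MakerWinsFrom X F a b B M → IsLegalMove b (X \ (B ∪ M)) S →
        MakerWinsFrom X F a b (B ∪ S) (M ∪ T)) := by
    intro B M S
    by_cases hw : MakerWinsFrom X F a b B M ∧ IsLegalMove b (X \ (B ∪ M)) S
    · obtain ⟨T, h1, h2⟩ := hw.1.exists_reply hw.2
      exact ⟨T, h1, fun _ _ => h2⟩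
    · obtain ⟨T, hT⟩ := IsLegalMove.exists a (X \ (B ∪ S ∪ M))
      exact ⟨T, hT, fun h1 h2 => (hw ⟨h1, h2⟩).elim⟩
  choose R hR1 hR2 using hR
  let step : Finset E × Finset E × Finset E → Finset E → Finset E × Finset E × Finset E :=
    fun p S => (p.1 ∪ S, p.2.1 ∪ R p.1 p.2.1 S, R p.1 p.2.1 S)
  refine ⟨fun L => (L.foldl step (∅, ∅, ∅)).2.2, fun S T hT => ?_⟩
  have hstate : ∀ i, ((history S i).foldl step (∅, ∅, ∅)).1 = claimed S i ∧
      ((history S i).foldl step (∅, ∅, ∅)).2.1 = claimed T i ∧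
      T i = R (claimed S i) (claimed T i) (S i) := by
    intro i
    induction i with
    | zero => simp [history, claimed_zero, hT, step]
    | succ i ih =>
      obtain ⟨h1, h2, h3⟩ := ih
      have h4 : ((history S (i + 1)).foldl step (∅, ∅, ∅)).1 = claimed S (i + 1) := by
        simp [history_succ, step, h1, claimed_succ]
      have h5 : ((history S (i + 1)).foldl step (∅, ∅, ∅)).2.1 = claimed T (i + 1) := by
        simp [history_succ, step, h1, h2, claimed_succ, ← h3]
      refine ⟨h4, h5, ?_⟩
      rw [hT, history_succ, ← h4, ← h5]
      simp [step]
  have hTi : ∀ i, T i = R (claimed S i) (claimed T i) (S i) := fun i => (hstate i).2.2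
  refine ⟨fun i _ => ?_, fun hleg => ?_⟩
  · rw [MakerLegal, claimed_succ, hTi]
    exact hR1 _ _ _
  · have hw : ∀ i, MakerWinsFrom X F a b (claimed S i) (claimed T i) := by
      intro i
      induction i with
      | zero => simpa [claimed_zero] using h
      | succ i ih =>
        rw [claimed_succ, claimed_succ, hTi]
        exact hR2 _ _ _ ih (hleg i)
    have hex := card_free_le hb hleg X.card
    rw [Nat.sub_self, Nat.le_zero, Finset.card_eq_zero] at hex
    obtain ⟨W, hW, hWM⟩ := (hw X.card).occupied_of_exhausted hex
    exact ⟨W, hW, X.card, hWM⟩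

/-- Determinacy: where Maker cannot force a win, some Breaker move leaves him unable to do so after
any reply. Breaker repeats such moves forever. -/
theorem breakerHasWinningStrategy_of_not_makerWinsFrom (h : ¬ MakerWinsFrom X F a b ∅ ∅) :
    BreakerHasWinningStrategy X F a b := by
  have hR : ∀ B M : Finset E, ∃ S, IsLegalMove b (X \ (B ∪ M)) S ∧
      (¬ MakerWinsFrom X F a b B M → ∀ T, IsLegalMove a (X \ (B ∪ S ∪ M)) T →
        ¬ MakerWinsFrom X F a b (B ∪ S) (M ∪ T)) := by
    intro B M
    by_cases hw : MakerWinsFrom X F a b B M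
    · obtain ⟨S, hS⟩ := IsLegalMove.exists b (X \ (B ∪ M))
      exact ⟨S, hS, fun h => (h hw).elim⟩
    · by_contra! hc
      exact hw (.of_replies fun S hS => (hc S hS).2)
  choose R hR1 hR2 using hR
  let step : Finset E × Finset E → Finset E → Finset E × Finset E :=
    fun p T => (p.1 ∪ R p.1 p.2, p.2 ∪ T)
  refine ⟨fun L => R (L.foldl step (∅, ∅)).1 (L.foldl step (∅, ∅)).2, fun S T hS => ?_⟩
  have hstate : ∀ i, (history T i).foldl step (∅, ∅) = (claimed S i, claimed T i) := by
    intro i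
    induction i with
    | zero => simp [history, claimed_zero]
    | succ i ih => simp [history_succ, ih, step, claimed_succ, hS i]
  have hSi : ∀ i, S i = R (claimed S i) (claimed T i) := fun i => by simp [hS, hstate]
  refine ⟨fun i _ => ?_, fun hleg => ?_⟩
  · rw [BreakerLegal, hSi]
    exact hR1 _ _
  · have hw : ∀ i, ¬ MakerWinsFrom X F a b (claimed S i) (claimed T i) := by
      intro i
      induction i with
      | zero => simpa [claimed_zero] using h
      | succ i ih =>
        have hl := hleg i
        rw [MakerLegal] at hl
        rw [claimed_succ] at hl ⊢
        rw [claimed_succ]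
        rw [hSi] at hl ⊢
        exact hR2 _ _ ih _ hl
    rintro ⟨W, hW, N, hN⟩
    exact hw N (.occupied hW hN)

/-- Maker simulates a game against the stronger Breaker, to whom he credits imaginary edges. `B'`
and `M'` are the imaginary position; Maker may really own edges that he credits to Breaker there. -/
theorem MakerWinsFrom.mono_breaker_bias {b' : ℕ} (hb : b ≤ b') {B' M' : Finset E}
    (h : MakerWinsFrom X F a b' B' M') :
    ∀ {B M : Finset E}, B ⊆ B' → M' ⊆ M → M ⊆ B' ∪ M' → MakerWinsFrom X F a b B M := by
  induction h with
  | occupied hW hWM => exact fun _ hM _ => .occupied hW (hWM.trans hM)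
  | @round B' M' R hR h ih =>
    intro B M hB hM hMB
    refine .of_replies fun S hS => ?_
    obtain ⟨S', hSS', hS'⟩ := IsLegalMove.exists_superset (k := b')
      (Finset.inter_subset_right : S ∩ (X \ (B' ∪ M')) ⊆ X \ (B' ∪ M'))
      ((Finset.card_le_card Finset.inter_subset_left).trans
        ((hS.2.le.trans (min_le_left _ _)).trans hb))
    have hBS : B ∪ S ⊆ B' ∪ S' := by
      intro e he
      rcases Finset.mem_union.1 he with he | he
      · exact Finset.mem_union_left _ (hB he)
      · have h1 := hS.1 he
        have h2 := @hSS' e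
        have h3 := @hM e
        simp only [Finset.mem_sdiff, Finset.mem_union, Finset.mem_inter] at *
        tauto
    have hfree : X \ (B' ∪ S' ∪ M') ⊆ X \ (B ∪ S ∪ M) := by
      intro e he
      have h1 := @hBS e
      have h3 := @hMB e
      simp only [Finset.mem_sdiff, Finset.mem_union] at *
      tauto
    have hT' := hR S' hS'
    obtain ⟨T, hTT, hT⟩ := IsLegalMove.exists_superset (k := a) (hT'.1.trans hfree)
      (hT'.2.le.trans (min_le_left _ _))
    refine ⟨T, hT, ih S' hS' hBS (Finset.union_subset_union hM hTT) ?_⟩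
    -- Either the imaginary reply already has `a` edges, so nothing is added to it, or it exhausts
    -- the imaginary board.
    have hTs : T ⊆ B' ∪ S' ∪ (M' ∪ R S') := by
      rcases le_total a (X \ (B' ∪ S' ∪ M')).card with hc | hc
      · have : R S' = T := by
          refine Finset.eq_of_subset_of_card_le hTT ?_
          rw [hT'.2, hT.2, min_eq_left hc]
          exact min_le_left _ _
        rw [this]
        exact Finset.subset_union_right.trans Finset.subset_union_right
      · have h1 : R S' = X \ (B' ∪ S' ∪ M') :=
          Finset.eq_of_subset_of_card_le hT'.1 (by rw [hT'.2, min_eq_right hc])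
        intro e he
        have h2 := hT.1 he
        rw [h1]
        simp only [Finset.mem_sdiff, Finset.mem_union] at *
        tauto
    intro e he
    rcases Finset.mem_union.1 he with he | he
    · have := hMB he
      simp only [Finset.mem_union] at *
      tauto
    · exact hTs he

/-- If Breaker wins for some positive bias then the threshold bias exists. -/
theorem exists_isThresholdBias (h : ∃ b, 1 ≤ b ∧ ¬ MakerWinsFrom X F a b ∅ ∅) :
    ∃ b₀, IsThresholdBias X F a b₀ ∧ ¬ MakerWinsFrom X F a b₀ ∅ ∅ ∧
      ∀ b, 1 ≤ b → b < b₀ → MakerWinsFrom X F a b ∅ ∅ := by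
  classical
  have hlt : ∀ b, 1 ≤ b → b < Nat.find h → MakerWinsFrom X F a b ∅ ∅ := fun b hb hlt => by
    by_contra hc
    exact Nat.find_min h hlt ⟨hb, hc⟩
  refine ⟨Nat.find h, ⟨(Nat.find_spec h).1, fun b hb hb0 =>
    (hlt b hb hb0).makerHasWinningStrategy hb, fun b hb => ?_⟩, (Nat.find_spec h).2, hlt⟩
  refine breakerHasWinningStrategy_of_not_makerWinsFrom fun hw => (Nat.find_spec h).2 ?_
  exact hw.mono_breaker_bias hb subset_rfl subset_rfl (by simp)

end PositionalGame

/-! ### Degrees, danger, and Maker's active vertices. -/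

section Connectivity

open Finset

variable {n : ℕ}

/-- The vertices joined to `v` by an edge of `B`. -/
def edgeNbrs (B : Finset (Sym2 (Fin n))) (v : Fin n) : Finset (Fin n) :=
  univ.filter fun u => s(v, u) ∈ B

theorem mem_edgeNbrs {B : Finset (Sym2 (Fin n))} {v u : Fin n} :
    u ∈ edgeNbrs B v ↔ s(v, u) ∈ B := by simp [edgeNbrs]

theorem edgeNbrs_mono {B B' : Finset (Sym2 (Fin n))} (h : B ⊆ B') (v : Fin n) :
    edgeNbrs B v ⊆ edgeNbrs B' v := fun u hu => by
  rw [mem_edgeNbrs] at *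
  exact h hu

theorem mk_mem_completeBoard {u v : Fin n} : s(u, v) ∈ completeBoard n ↔ u ≠ v := by
  simp [completeBoard]

theorem sum_card_edgeNbrs_le (B : Finset (Sym2 (Fin n))) :
    ∑ v, (edgeNbrs B v).card ≤ 2 * B.card := by
  rw [← card_sigma]
  refine card_le_mul_card_image_of_maps_to (f := fun p : (_ : Fin n) × Fin n => s(p.1, p.2))
    (fun p hp => ?_) 2 fun e he => ?_
  · exact mem_edgeNbrs.1 (mem_sigma.1 hp).2
  · induction e with
    | _ x y =>
      refine (card_le_card (t := {⟨x, y⟩, ⟨y, x⟩}) fun p hp => ?_).trans card_le_two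
      have := (mem_filter.1 hp).2
      obtain ⟨p1, p2⟩ := p
      simp only [Sym2.eq_iff] at this
      simp only [mem_insert, mem_singleton, Sigma.mk.injEq, heq_eq_eq]
      exact this

/-- The vertices of degree more than `m` in the graph with edge set `B`. -/
def heavy (B : Finset (Sym2 (Fin n))) (m : ℕ) : Finset (Fin n) :=
  univ.filter fun v => m < (edgeNbrs B v).card

/-- The larger of `m` and the number of vertices of degree at most `m` joined to `v`. -/
def danger (B : Finset (Sym2 (Fin n))) (m : ℕ) (v : Fin n) : ℕ :=
  max m (edgeNbrs B v \ heavy B m).card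

/-- The number of edges of `S` that join the vertex `v`, if it is heavy in `B`, to a vertex that is
not heavy in `B`. -/
def heavyGain (B S : Finset (Sym2 (Fin n))) (m : ℕ) (v : Fin n) : ℕ :=
  if v ∈ heavy B m then (edgeNbrs S v \ heavy B m).card else 0

theorem mem_heavy {B : Finset (Sym2 (Fin n))} {m : ℕ} {v : Fin n} :
    v ∈ heavy B m ↔ m < (edgeNbrs B v).card := by simp [heavy]

theorem heavy_mono {B B' : Finset (Sym2 (Fin n))} (h : B ⊆ B') (m : ℕ) :
    heavy B m ⊆ heavy B' m := fun v hv => by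
  rw [mem_heavy] at *
  exact hv.trans_le (card_le_card (edgeNbrs_mono h v))

theorem card_heavy_mul_le (B : Finset (Sym2 (Fin n))) (m : ℕ) :
    (heavy B m).card * m ≤ 2 * B.card := by
  refine le_trans ?_ (sum_card_edgeNbrs_le B)
  rw [← smul_eq_mul, ← sum_const]
  exact (sum_le_sum fun v hv => (mem_heavy.1 hv).le).trans
    (sum_le_sum_of_subset (subset_univ _))

theorem card_edgeNbrs_le_danger (B : Finset (Sym2 (Fin n))) (m : ℕ) (v : Fin n) :
    (edgeNbrs B v).card ≤ danger B m v + (heavy B m).card := by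
  have h1 := le_card_sdiff (heavy B m) (edgeNbrs B v)
  have h2 : (edgeNbrs B v \ heavy B m).card ≤ danger B m v := le_max_right _ _
  omega

/-- The heavy set only grows, so old heavy neighbours never become light. A vertex still light after
the move has danger exactly `m`, which is what the floor in `danger` is for. -/
theorem danger_union_le (B S : Finset (Sym2 (Fin n))) (m : ℕ) (v : Fin n) :
    danger (B ∪ S) m v ≤ danger B m v + heavyGain (B ∪ S) S m v := by
  unfold danger heavyGain
  split_ifs with hv
  · refine max_le ((le_max_left _ _).trans (Nat.le_add_right _ _)) ?_
    have h : edgeNbrs (B ∪ S) v \ heavy (B ∪ S) m ⊆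
        (edgeNbrs B v \ heavy B m) ∪ (edgeNbrs S v \ heavy (B ∪ S) m) := by
      intro u hu
      have := @heavy_mono n B (B ∪ S) subset_union_left m u
      simp only [Finset.mem_sdiff, mem_union, mem_edgeNbrs] at *
      tauto
    exact (card_le_card h).trans ((card_union_le _ _).trans (Nat.add_le_add_right
      (le_max_right _ _) _))
  · refine max_le ((le_max_left _ _).trans (Nat.le_add_right _ _)) ?_
    rw [mem_heavy, not_lt] at hv
    exact ((card_le_card sdiff_subset).trans hv).trans
      ((le_max_left _ _).trans (Nat.le_add_right _ _))

/-- An edge counted here has exactly one heavy end, so it is counted once. Plain degrees would cost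
a factor of two. -/
theorem sum_heavyGain_le (B S : Finset (Sym2 (Fin n))) (m : ℕ) :
    ∑ v, heavyGain B S m v ≤ S.card := by
  have h : ∑ v, heavyGain B S m v = ∑ v ∈ heavy B m, (edgeNbrs S v \ heavy B m).card := by
    simp only [heavyGain]
    rw [← sum_filter]
    simp
  rw [h, ← card_sigma]
  refine card_le_card_of_injOn (fun p : (_ : Fin n) × Fin n => s(p.1, p.2)) (fun p hp => ?_) ?_
  · have := (mem_sigma.1 hp).2
    rw [Finset.mem_sdiff, mem_edgeNbrs] at this
    exact this.1
  · rintro ⟨p1, p2⟩ hp ⟨q1, q2⟩ hq h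
    simp only [coe_sigma, Set.mem_sigma_iff, mem_coe, Finset.mem_sdiff] at hp hq
    simp only [Sym2.eq_iff] at h
    rcases h with ⟨rfl, rfl⟩ | ⟨rfl, rfl⟩
    · rfl
    · exact (hq.2.2 hp.1).elim

/-- Every vertex is joined to a vertex in `A` by a path of edges in `M`. -/
def ReachCover (M : Finset (Sym2 (Fin n))) (A : Finset (Fin n)) : Prop :=
  ∀ x, ∃ w ∈ A, (SimpleGraph.fromEdgeSet (M : Set (Sym2 (Fin n)))).Reachable x w

theorem reachable_mono {M M' : Finset (Sym2 (Fin n))} (h : M ⊆ M') {x y : Fin n}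
    (hr : (SimpleGraph.fromEdgeSet (M : Set (Sym2 (Fin n)))).Reachable x y) :
    (SimpleGraph.fromEdgeSet (M' : Set (Sym2 (Fin n)))).Reachable x y :=
  hr.mono (SimpleGraph.fromEdgeSet_mono (coe_subset.2 h))

theorem ReachCover.mono {M M' : Finset (Sym2 (Fin n))} {A : Finset (Fin n)}
    (h : ReachCover M A) (hM : M ⊆ M') : ReachCover M' A := fun x =>
  let ⟨w, hw, hr⟩ := h x
  ⟨w, hw, reachable_mono hM hr⟩

theorem ReachCover.occupied {M : Finset (Sym2 (Fin n))} {A : Finset (Fin n)}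
    (h : ReachCover M A) (hA : A.card = 1) :
    ∃ W ∈ connectedSpanningSets n, W ⊆ M := by
  obtain ⟨w, rfl⟩ := card_eq_one.1 hA
  refine ⟨M ∩ completeBoard n, ⟨inter_subset_right, ?_⟩, inter_subset_left⟩
  have hG : SimpleGraph.fromEdgeSet ((M ∩ completeBoard n : Finset (Sym2 (Fin n))) :
      Set (Sym2 (Fin n))) = SimpleGraph.fromEdgeSet (M : Set (Sym2 (Fin n))) := by
    ext x y
    simp only [SimpleGraph.fromEdgeSet_adj, mem_coe, mem_inter, mk_mem_completeBoard]
    tauto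
  rw [hG]
  have hw : ∀ x, (SimpleGraph.fromEdgeSet (M : Set (Sym2 (Fin n)))).Reachable x w := fun x => by
    obtain ⟨w', hw', hr⟩ := h x
    rwa [mem_singleton.1 hw'] at hr
  exact { preconnected := fun x y => (hw x).trans (hw y).symm, nonempty := ⟨w⟩ }

theorem card_mul_card_compl_le {B : Finset (Sym2 (Fin n))} {C : Finset (Fin n)}
    (h : ∀ x ∈ C, ∀ y ∉ C, s(x, y) ∈ B) : C.card * (n - C.card) ≤ B.card := by
  have h1 : C.card * (n - C.card) = (C ×ˢ Cᶜ).card := by simp [card_compl]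
  rw [h1]
  refine card_le_card_of_injOn (fun p : Fin n × Fin n => s(p.1, p.2)) (fun p hp => ?_) ?_
  · have := mem_product.1 hp
    exact h _ this.1 _ (mem_compl.1 this.2)
  · rintro ⟨p1, p2⟩ hp ⟨q1, q2⟩ hq h
    simp only [mem_coe, mem_product, mem_compl] at hp hq
    simp only [Sym2.eq_iff] at h
    rcases h with ⟨rfl, rfl⟩ | ⟨rfl, rfl⟩
    · rfl
    · exact (hq.2 hp.1).elim

/-- If all edges between `C` and its complement lie in `B` and `C` is not the larger side, then the
vertices of `C` have large degree. -/
theorem le_card_edgeNbrs_of_cut {B : Finset (Sym2 (Fin n))} {C : Finset (Fin n)}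
    (h : ∀ x ∈ C, ∀ y ∉ C, s(x, y) ∈ B) (hC : 2 * C.card ≤ n) {w : Fin n} (hw : w ∈ C) :
    C.card * n ≤ 2 * B.card ∧ n ≤ (edgeNbrs B w).card + C.card := by
  constructor
  · have h1 := card_mul_card_compl_le h
    have h2 : C.card * n ≤ C.card * (2 * (n - C.card)) := Nat.mul_le_mul_left _ (by omega)
    calc C.card * n ≤ C.card * (2 * (n - C.card)) := h2
      _ = 2 * (C.card * (n - C.card)) := by ring
      _ ≤ _ := by omega
  · have h1 : Cᶜ ⊆ edgeNbrs B w := fun y hy => mem_edgeNbrs.2 (h w hw y (mem_compl.1 hy))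
    have h2 := card_le_card h1
    rw [card_compl, Fintype.card_fin] at h2
    omega

/-- If `v` is not already connected to another active `w`, Maker needs an edge leaving the component
of `v`. Were that whole cut Breaker's, the smaller side, of size `k`, would contain `v` or `w` with
Breaker degree at least `n - k`, against `hB`. -/
theorem ReachCover.exists_erase {B M : Finset (Sym2 (Fin n))} {A : Finset (Fin n)}
    (h : ReachCover M A)
    (hB : ∀ w ∈ A, ∀ k, k * n ≤ 2 * B.card → (edgeNbrs B w).card + k < n)
    {v : Fin n} (hv : v ∈ A) (hA : 2 ≤ A.card) :
    ∃ T ⊆ completeBoard n \ (B ∪ M), T.card ≤ 1 ∧ ReachCover (M ∪ T) (A.erase v) := by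
  classical
  have key : ∀ T : Finset (Sym2 (Fin n)), (∃ w ∈ A, w ≠ v ∧
      (SimpleGraph.fromEdgeSet ((M ∪ T : Finset (Sym2 (Fin n))) : Set (Sym2 (Fin n)))).Reachable
        v w) → ReachCover (M ∪ T) (A.erase v) := by
    rintro T ⟨w, hwA, hwv, hr⟩ x
    obtain ⟨u, hu, hxu⟩ := h.mono (subset_union_left (s₂ := T)) x
    by_cases huv : u = v
    · subst huv
      exact ⟨w, mem_erase.2 ⟨hwv, hwA⟩, hxu.trans hr⟩
    · exact ⟨u, mem_erase.2 ⟨huv, hu⟩, hxu⟩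
  set G := SimpleGraph.fromEdgeSet (M : Set (Sym2 (Fin n))) with hG
  obtain ⟨w, hwA, hwv⟩ := exists_mem_ne (by omega : 1 < A.card) v
  by_cases hvw : G.Reachable v w
  · exact ⟨∅, empty_subset _, by simp, key ∅ ⟨w, hwA, hwv, reachable_mono subset_union_left hvw⟩⟩
  let C : Finset (Fin n) := univ.filter fun x => G.Reachable v x
  have hC : ∀ x, x ∈ C ↔ G.Reachable v x := fun x => by simp [C]
  have hcut : ∃ x ∈ C, ∃ y ∉ C, s(x, y) ∉ B := by
    by_contra! hc
    rcases le_total (2 * C.card) n with hle | hle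
    · obtain ⟨h1, h2⟩ := le_card_edgeNbrs_of_cut hc hle ((hC v).2 (SimpleGraph.Reachable.refl v))
      have := hB v hv _ h1
      omega
    · obtain ⟨h1, h2⟩ := le_card_edgeNbrs_of_cut (C := Cᶜ) (B := B) (w := w)
        (fun x hx y hy => by
          rw [Sym2.eq_swap]
          exact hc y (by simpa using hy) x (by simpa using hx))
        (by rw [card_compl, Fintype.card_fin]; omega) (by simpa [hC] using hvw)
      have := hB w hwA _ h1
      omega
  obtain ⟨x, hx, y, hy, hxy⟩ := hcut
  have hne : x ≠ y := fun h => hy (h ▸ hx)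
  rw [hC] at hx hy
  have hM : s(x, y) ∉ M := fun hm => hy (hx.trans (SimpleGraph.Adj.reachable
    ((SimpleGraph.fromEdgeSet_adj _).2 ⟨hm, hne⟩)))
  refine ⟨{s(x, y)}, ?_, by simp, key _ ?_⟩
  · rw [singleton_subset_iff, Finset.mem_sdiff, mem_union, mk_mem_completeBoard]
    tauto
  · obtain ⟨u, hu, hyu⟩ := h y
    refine ⟨u, hu, ?_, ?_⟩
    · rintro rfl
      exact hy hyu.symm
    · refine (reachable_mono subset_union_left hx).trans ((SimpleGraph.Adj.reachable ?_).trans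
        (reachable_mono subset_union_left hyu))
      rw [SimpleGraph.fromEdgeSet_adj]
      exact ⟨by simp, hne⟩

/-- Maker can remove the `j` most dangerous vertices from a cover by claiming at most `j` edges. -/
theorem ReachCover.exists_remove_top {B M : Finset (Sym2 (Fin n))} {A : Finset (Fin n)}
    (h : ReachCover M A)
    (hB : ∀ w ∈ A, ∀ k, k * n ≤ 2 * B.card → (edgeNbrs B w).card + k < n)
    (f : Fin n → ℕ) (j : ℕ) (hj : j < A.card) :
    ∃ T ⊆ completeBoard n \ (B ∪ M), T.card ≤ j ∧ ∃ A' ⊆ A, A'.card = A.card - j ∧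
      ReachCover (M ∪ T) A' ∧ ∀ u ∈ A \ A', ∀ w ∈ A', f w ≤ f u := by
  induction j with
  | zero => exact ⟨∅, empty_subset _, by simp, A, subset_rfl, by simp, by simpa using h, by simp⟩
  | succ j ih =>
    obtain ⟨T, hT, hTc, A', hA', hA'c, hcov, htop⟩ := ih (by omega)
    obtain ⟨v, hv, hmax⟩ := A'.exists_max_image f (card_pos.1 (by omega))
    obtain ⟨T', hT', hT'c, hcov'⟩ := hcov.exists_erase (B := B)
      (fun w hw => hB w (hA' hw)) hv (by omega)
    refine ⟨T ∪ T', union_subset hT (hT'.trans ?_), (card_union_le _ _).trans (by omega),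
      A'.erase v, (erase_subset _ _).trans hA', by rw [card_erase_of_mem hv]; omega,
      by rwa [← union_assoc], fun u hu w hw => ?_⟩
    · intro e
      simp only [Finset.mem_sdiff, mem_union]
      tauto
    · have hwA := mem_of_mem_erase hw
      rw [Finset.mem_sdiff, mem_erase, not_and_or, not_not] at hu
      rcases hu with ⟨huA, rfl | hu⟩
      · exact hmax w hwA
      · exact htop u (Finset.mem_sdiff.2 ⟨huA, hu⟩) w hwA

end Connectivity

/-! ### The exponential potential. -/

section Potential

open Finset

/-- Fractional knapsack: with weights in `[0, 1]` and a bounded total, nothing beats full weight on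
the largest values. -/
theorem sum_mul_le_sum_top {ι : Type*} [DecidableEq ι] {A A' : Finset ι} (hA : A' ⊆ A)
    {y w : ι → ℝ} (hy : ∀ v ∈ A, 0 ≤ y v) (hw0 : ∀ v ∈ A, 0 ≤ w v) (hw1 : ∀ v ∈ A, w v ≤ 1)
    (hw : ∑ v ∈ A, w v ≤ (A \ A').card) (htop : ∀ u ∈ A \ A', ∀ v ∈ A', y v ≤ y u) :
    ∑ v ∈ A, w v * y v ≤ ∑ v ∈ A \ A', y v := by
  rw [← sum_sdiff hA] at hw ⊢
  rcases A'.eq_empty_or_nonempty with rfl | hne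
  · simp only [sdiff_empty, sum_empty, add_zero]
    exact sum_le_sum fun v hv => mul_le_of_le_one_left (hy v hv) (hw1 v hv)
  obtain ⟨v₀, hv₀, hmax⟩ := A'.exists_max_image y hne
  have h1 : ∑ v ∈ A', w v * y v ≤ (∑ v ∈ A', w v) * y v₀ := by
    rw [sum_mul]
    exact sum_le_sum fun v hv => mul_le_mul_of_nonneg_left (hmax v hv) (hw0 v (hA hv))
  have h2 : (∑ v ∈ A \ A', (1 - w v)) * y v₀ ≤ ∑ v ∈ A \ A', (1 - w v) * y v := by
    rw [sum_mul]
    exact sum_le_sum fun v hv => mul_le_mul_of_nonneg_left (htop v hv v₀ hv₀)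
      (sub_nonneg.2 (hw1 v (sdiff_subset hv)))
  have h3 : ∑ v ∈ A', w v ≤ ∑ v ∈ A \ A', (1 - w v) := by
    rw [sum_sub_distrib, sum_const, nsmul_eq_mul, mul_one]
    linarith
  have h4 := mul_le_mul_of_nonneg_right h3 (hy v₀ (hA hv₀))
  have h5 : ∑ v ∈ A \ A', (1 - w v) * y v =
      ∑ v ∈ A \ A', y v - ∑ v ∈ A \ A', w v * y v := by
    rw [← sum_sub_distrib]
    exact sum_congr rfl fun v _ => by ring
  linarith

/-- If the values of `g` grow by at most `x` and then the `θ ∑ x` largest ones are discarded, then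
the exponential potential does not increase. -/
theorem sum_exp_le_of_top_removed {ι : Type*} [DecidableEq ι] {A A' : Finset ι} (hA : A' ⊆ A)
    {θ : ℝ} (hθ : 0 ≤ θ) {g g' x : ι → ℕ} (hg : ∀ v ∈ A, g' v ≤ g v + x v)
    (hx : θ * ∑ v ∈ A, (x v : ℝ) ≤ (A \ A').card)
    (htop : ∀ u ∈ A \ A', ∀ v ∈ A', g' v ≤ g' u) :
    ∑ v ∈ A', Real.exp (θ * g' v) ≤ ∑ v ∈ A, Real.exp (θ * g v) := by
  -- The weight `1 - exp (-θ x)` bounds the fraction of the new term that is due to growth, and it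
  -- is at most `θ x`.
  have h1 := sum_mul_le_sum_top hA (y := fun v => Real.exp (θ * g' v))
    (w := fun v => 1 - Real.exp (-(θ * x v))) (fun v _ => (Real.exp_pos _).le)
    (fun v _ => sub_nonneg.2 (Real.exp_le_one_iff.2 (by simp; positivity)))
    (fun v _ => by simp [(Real.exp_pos _).le])
    (le_trans (by
      rw [mul_sum]
      exact sum_le_sum fun v _ => by linarith [Real.add_one_le_exp (-(θ * x v))]) hx)
    (fun u hu v hv => Real.exp_le_exp.2 (mul_le_mul_of_nonneg_left
      (by exact_mod_cast htop u hu v hv) hθ))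
  have h2 : ∑ v ∈ A, Real.exp (θ * g' v) - ∑ v ∈ A, (1 - Real.exp (-(θ * x v))) *
      Real.exp (θ * g' v) ≤ ∑ v ∈ A, Real.exp (θ * g v) := by
    rw [← sum_sub_distrib]
    refine sum_le_sum fun v hv => ?_
    have : Real.exp (θ * g' v) - (1 - Real.exp (-(θ * x v))) * Real.exp (θ * g' v) =
        Real.exp (-(θ * x v) + θ * g' v) := by rw [Real.exp_add]; ring
    rw [this, Real.exp_le_exp]
    have h3 : (g' v : ℝ) ≤ g v + x v := by exact_mod_cast hg v hv
    nlinarith [mul_le_mul_of_nonneg_left h3 hθ]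
  have h3 := sum_sdiff (f := fun v => Real.exp (θ * g' v)) hA
  linarith

end Potential

/-! ### Maker's strategy. -/

section MakerStrategy

open Finset

variable {n : ℕ}

/-- `hpot` bounds each active danger. `hcount` records that `b` Breaker edges are paid for by `a`
deactivations, so Breaker never has more than `Q` edges when Maker replies. In `hsum`, `2 * Q / m`
bounds the number of heavy vertices and `2 * Q / n` the smaller side of a cut owned by Breaker. -/
theorem makerWinsFrom_of_reachCover {a b m : ℕ} (ha : 1 ≤ a) (hb : 1 ≤ b) (hm : 1 ≤ m) {Q : ℝ}
    (hQ : Q = b * (n / a + 1))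
    (hsum : (b / a : ℝ) * Real.log n + m + b + 2 * Q / m + 2 * Q / n < n) {k : ℕ}
    {B M : Finset (Sym2 (Fin n))} {A : Finset (Fin n)} (hk : A.card = k) (hA : A.Nonempty)
    (hcov : ReachCover M A)
    (hpot : ∑ v ∈ A, Real.exp ((a / b : ℝ) * danger B m v) ≤ n * Real.exp ((a / b : ℝ) * m))
    (hcount : a * B.card + b * A.card ≤ b * n) :
    MakerWinsFrom (completeBoard n) (connectedSpanningSets n) a b B M := by
  induction k using Nat.strong_induction_on generalizing B M A with
  | _ k ih =>
  subst hk
  have ha0 : (0 : ℝ) < a := by exact_mod_cast ha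
  have hb0 : (0 : ℝ) < b := by exact_mod_cast hb
  have hm0 : (0 : ℝ) < m := by exact_mod_cast hm
  have hn0 : (0 : ℝ) < n := by
    obtain ⟨v, -⟩ := hA
    exact_mod_cast v.pos
  refine .of_replies fun S hS => ?_
  have hSb : S.card ≤ b := hS.2.le.trans (min_le_left _ _)
  have hB1 : (B ∪ S).card ≤ B.card + b := (card_union_le _ _).trans (by omega)
  have hgain : ∀ v ∈ A, danger (B ∪ S) m v ≤ danger B m v + heavyGain (B ∪ S) S m v :=
    fun v _ => danger_union_le B S m v
  have hgsum : ∑ v, heavyGain (B ∪ S) S m v ≤ b := (sum_heavyGain_le _ _ _).trans hSb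
  have hBQ : ((B ∪ S).card : ℝ) ≤ Q := by
    have h1 : a * (B ∪ S).card ≤ b * n + a * b := by nlinarith
    have h2 : (a : ℝ) * (B ∪ S).card ≤ b * n + a * b := by exact_mod_cast h1
    have h3 : (a : ℝ) * Q = b * n + a * b := by rw [hQ]; field_simp
    exact le_of_mul_le_mul_left (h2.trans h3.ge) ha0
  have hB : ∀ w ∈ A, ∀ k, k * n ≤ 2 * (B ∪ S).card → (edgeNbrs (B ∪ S) w).card + k < n := by
    intro w hw k hk
    have h1 : (k : ℝ) ≤ 2 * Q / n := by
      rw [le_div_iff₀ hn0]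
      have : (k : ℝ) * n ≤ 2 * (B ∪ S).card := by exact_mod_cast hk
      linarith
    have h2 : ((heavy (B ∪ S) m).card : ℝ) ≤ 2 * Q / m := by
      rw [le_div_iff₀ hm0]
      have : ((heavy (B ∪ S) m).card : ℝ) * m ≤ 2 * (B ∪ S).card := by
        exact_mod_cast card_heavy_mul_le (B ∪ S) m
      linarith
    have h3 : (danger B m w : ℝ) ≤ (b / a : ℝ) * Real.log n + m := by
      have h4 : Real.exp ((a / b : ℝ) * danger B m w) ≤
          Real.exp (Real.log n + (a / b : ℝ) * m) := by
        rw [Real.exp_add, Real.exp_log hn0]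
        exact (single_le_sum (f := fun v => Real.exp ((a / b : ℝ) * danger B m v))
          (fun v _ => (Real.exp_pos _).le) hw).trans hpot
      have h5 := mul_le_mul_of_nonneg_left (Real.exp_le_exp.1 h4) (div_pos hb0 ha0).le
      calc (danger B m w : ℝ) = b / a * (a / b * danger B m w) := by field_simp
        _ ≤ b / a * (Real.log n + a / b * m) := h5
        _ = _ := by field_simp
    have h6 : heavyGain (B ∪ S) S m w ≤ b :=
      (single_le_sum (f := fun v => heavyGain (B ∪ S) S m v) (fun _ _ => Nat.zero_le _)
        (mem_univ w)).trans hgsum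
    have h7 : ((edgeNbrs (B ∪ S) w).card : ℝ) ≤ danger B m w + b + (heavy (B ∪ S) m).card := by
      have h8 := card_edgeNbrs_le_danger (B ∪ S) m w
      have h9 := hgain w hw
      have : (edgeNbrs (B ∪ S) w).card ≤ danger B m w + b + (heavy (B ∪ S) m).card := by omega
      exact_mod_cast this
    have h10 : ((edgeNbrs (B ∪ S) w).card : ℝ) + k < n := by linarith
    exact_mod_cast h10
  rcases Nat.lt_or_ge a A.card with hlt | hge
  · obtain ⟨T₀, hT₀, hT₀c, A', hA', hA'c, hcov', htop⟩ :=
      hcov.exists_remove_top hB (danger (B ∪ S) m) a hlt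
    obtain ⟨T, hTT, hT⟩ := IsLegalMove.exists_superset hT₀ hT₀c
    refine ⟨T, hT, ih A'.card (by omega) rfl (card_pos.1 (by omega))
      (hcov'.mono (union_subset_union subset_rfl hTT)) (le_trans ?_ hpot) ?_⟩
    · refine sum_exp_le_of_top_removed hA' (div_pos ha0 hb0).le hgain ?_ htop
      have h1 : (A \ A').card = a := by rw [card_sdiff_of_subset hA']; omega
      have h2 : (∑ v ∈ A, (heavyGain (B ∪ S) S m v : ℝ)) ≤ b := by
        exact_mod_cast (sum_le_sum_of_subset (subset_univ A)).trans hgsum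
      rw [h1]
      calc (a / b : ℝ) * ∑ v ∈ A, (heavyGain (B ∪ S) S m v : ℝ) ≤ a / b * b :=
            mul_le_mul_of_nonneg_left h2 (div_pos ha0 hb0).le
        _ = a := by field_simp
    · obtain ⟨c, hc⟩ := Nat.exists_eq_add_of_lt hlt
      have hA'c' : A'.card = c + 1 := by omega
      rw [hA'c']
      rw [hc] at hcount
      nlinarith
  -- Last round: Maker's bias suffices to deactivate all active vertices but one.
  · have hpos := card_pos.2 hA
    obtain ⟨T₀, hT₀, hT₀c, A', hA', hA'c, hcov', -⟩ :=
      hcov.exists_remove_top hB (danger (B ∪ S) m) (A.card - 1) (by omega)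
    obtain ⟨T, hTT, hT⟩ := IsLegalMove.exists_superset (k := a) hT₀ (by omega)
    obtain ⟨W, hW, hWM⟩ := (hcov'.mono (union_subset_union (subset_refl M) hTT)).occupied (by omega)
    exact ⟨T, hT, .occupied hW hWM⟩

theorem makerWinsFrom_empty {a b m : ℕ} (hn : 1 ≤ n) (ha : 1 ≤ a) (hb : 1 ≤ b) (hm : 1 ≤ m)
    {Q : ℝ} (hQ : Q = b * (n / a + 1))
    (hsum : (b / a : ℝ) * Real.log n + m + b + 2 * Q / m + 2 * Q / n < n) :
    MakerWinsFrom (completeBoard n) (connectedSpanningSets n) a b ∅ ∅ := by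
  have : NeZero n := ⟨by omega⟩
  refine makerWinsFrom_of_reachCover ha hb hm hQ hsum (A := univ) rfl univ_nonempty
    (fun x => ⟨x, mem_univ _, SimpleGraph.Reachable.refl x⟩) ?_ (by simp)
  have h : ∀ v : Fin n, danger ∅ m v = m := fun v => by simp [danger, edgeNbrs]
  simp [h]

end MakerStrategy

/-! ### Breaker's strategy: a clique, then the box game. -/

section BreakerStrategy

open Finset

variable {n a b : ℕ}

theorem not_makerWinsFrom_of_isolated (hn : 2 ≤ n) {B M : Finset (Sym2 (Fin n))} {v : Fin n}
    (hM : ∀ u, s(v, u) ∉ M) (hB : ∀ u, u ≠ v → s(v, u) ∈ B) :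
    ¬ MakerWinsFrom (completeBoard n) (connectedSpanningSets n) a b B M := by
  intro h
  induction h with
  | @occupied B M W hW hWM =>
    have : Nontrivial (Fin n) := Fin.nontrivial_iff_two_le.2 hn
    obtain ⟨u, hu⟩ := hW.2.preconnected.exists_adj_of_nontrivial v
    rw [SimpleGraph.fromEdgeSet_adj] at hu
    exact hM u (hWM hu.1)
  | @round B M R hR h ih =>
    obtain ⟨S, hS⟩ := IsLegalMove.exists b (completeBoard n \ (B ∪ M))
    refine ih S hS (fun u hu => ?_) fun u hu => mem_union_left _ (hB u hu)
    rcases mem_union.1 hu with hu | hu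
    · exact hM u hu
    · have h1 := (hR S hS).1 hu
      rw [Finset.mem_sdiff, mk_mem_completeBoard, mem_union, mem_union] at h1
      exact h1.2 (Or.inl (Or.inl (hB u (Ne.symm h1.1))))

theorem not_makerWinsFrom_of_move {B M S₀ : Finset (Sym2 (Fin n))}
    (hS₀ : S₀ ⊆ completeBoard n \ (B ∪ M)) (hb : S₀.card ≤ b)
    (h : ∀ S T, S₀ ⊆ S → IsLegalMove a (completeBoard n \ (B ∪ S ∪ M)) T →
      ¬ MakerWinsFrom (completeBoard n) (connectedSpanningSets n) a b (B ∪ S) (M ∪ T)) :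
    ¬ MakerWinsFrom (completeBoard n) (connectedSpanningSets n) a b B M := by
  intro hw
  obtain ⟨S, hSS, hS⟩ := IsLegalMove.exists_superset hS₀ hb
  obtain ⟨T, hT, hw'⟩ := hw.exists_reply hS
  exact h S T hSS hT hw'

/-- `C` is a clique of edges in `B` whose vertices are not incident to any edge of `M`. -/
structure IsUntouchedClique (B M : Finset (Sym2 (Fin n))) (C : Finset (Fin n)) : Prop where
  untouched : ∀ c ∈ C, ∀ u, s(c, u) ∉ M
  clique : ∀ c ∈ C, ∀ d ∈ C, c ≠ d → s(c, d) ∈ B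

/-- Every edge that Maker claims destroys at most one vertex of an untouched clique. -/
theorem IsUntouchedClique.exists_after_move {B M T : Finset (Sym2 (Fin n))} {C : Finset (Fin n)}
    (hM : ∀ c ∈ C, ∀ u, s(c, u) ∉ M) (hC : ∀ c ∈ C, ∀ d ∈ C, c ≠ d → s(c, d) ∈ B)
    (hT : IsLegalMove a (completeBoard n \ (B ∪ M)) T) {k : ℕ} (hk : k + a ≤ C.card) :
    ∃ C' ⊆ C, C'.card = k ∧ IsUntouchedClique B (M ∪ T) C' := by
  classical
  let D := C.filter fun c => ∃ u, s(c, u) ∈ T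
  have hD : D.card ≤ T.card := by
    have h1 : ∀ c ∈ D, ∃ u, s(c, u) ∈ T := fun c hc => (mem_filter.1 hc).2
    choose! f hf using h1
    -- Edges inside `C` belong to Breaker, so no Maker edge can touch two vertices of `C`.
    refine card_le_card_of_injOn (fun c => s(c, f c)) (fun c hc => hf c hc) ?_
    intro c hc d hd hcd
    by_contra hne
    simp only [Sym2.eq_iff] at hcd
    rcases hcd with ⟨h, -⟩ | ⟨-, h⟩
    · exact hne h
    · have h2 := hT.1 (hf c hc)
      rw [h, Finset.mem_sdiff, mem_union] at h2
      exact h2.2 (Or.inl (hC c (mem_filter.1 hc).1 d (mem_filter.1 hd).1 hne))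
  have hDa : D.card ≤ a := hD.trans (hT.2.le.trans (min_le_left _ _))
  have hcard : k ≤ (C \ D).card := by
    have := le_card_sdiff D C
    omega
  obtain ⟨C', hC', hC'k⟩ := exists_subset_card_eq hcard
  refine ⟨C', hC'.trans sdiff_subset, hC'k, fun c hc u hu => ?_, fun c hc d hd =>
    hC c (sdiff_subset (hC' hc)) d (sdiff_subset (hC' hd))⟩
  have hc' := Finset.mem_sdiff.1 (hC' hc)
  rcases mem_union.1 hu with hu | hu
  · exact hM c hc'.1 u hu
  · exact hc'.2 (mem_filter.2 ⟨hc'.1, u, hu⟩)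

/-- The other ends of the edges at `c` outside `B`. -/
def missingNbrs (B : Finset (Sym2 (Fin n))) (c : Fin n) : Finset (Fin n) :=
  univ.filter fun u => u ≠ c ∧ s(c, u) ∉ B

theorem mem_missingNbrs {B : Finset (Sym2 (Fin n))} {c u : Fin n} :
    u ∈ missingNbrs B c ↔ u ≠ c ∧ s(c, u) ∉ B := by simp [missingNbrs]

theorem missingNbrs_subset_of_subset {B B' : Finset (Sym2 (Fin n))} (h : B ⊆ B') (c : Fin n) :
    missingNbrs B' c ⊆ missingNbrs B c := fun u hu => by
  rw [mem_missingNbrs] at *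
  exact ⟨hu.1, fun hc => hu.2 (h hc)⟩

theorem card_missingNbrs_le (B : Finset (Sym2 (Fin n))) (c : Fin n) :
    (missingNbrs B c).card ≤ n - 1 := by
  have h : missingNbrs B c ⊆ univ.erase c := fun u hu =>
    mem_erase.2 ⟨(mem_missingNbrs.1 hu).1, mem_univ _⟩
  simpa using card_le_card h

/-- The box game played on the stars centred in an untouched clique. -/
theorem not_makerWinsFrom_of_untouchedClique (hn : 2 ≤ n) (j : ℕ)
    {B M : Finset (Sym2 (Fin n))} {C : Finset (Fin n)} (hC : IsUntouchedClique B M C)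
    (hcard : C.card = 1 + j * a)
    (hfree : ∀ c ∈ C, (missingNbrs B c).card ≤ ∑ i ∈ range (j + 1), b / (1 + i * a)) :
    ¬ MakerWinsFrom (completeBoard n) (connectedSpanningSets n) a b B M := by
  classical
  induction j generalizing B M C with
  | zero =>
    obtain ⟨c, rfl⟩ := card_eq_one.1 (hcard.trans (by simp))
    have hcM := hC.untouched c (mem_singleton_self c)
    refine not_makerWinsFrom_of_move (S₀ := (missingNbrs B c).image fun u => s(c, u))
      (fun e he => ?_) (card_image_le.trans ?_) fun S T hS hT => ?_
    · obtain ⟨u, hu, rfl⟩ := mem_image.1 he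
      rw [mem_missingNbrs] at hu
      simp only [Finset.mem_sdiff, mk_mem_completeBoard, mem_union, not_or]
      exact ⟨hu.1.symm, hu.2, hcM u⟩
    · simpa using hfree c (mem_singleton_self c)
    · have hBS : ∀ u, u ≠ c → s(c, u) ∈ B ∪ S := fun u hu => by
        by_cases huB : s(c, u) ∈ B
        · exact mem_union_left _ huB
        · exact mem_union_right _ (hS (mem_image_of_mem _ (mem_missingNbrs.2 ⟨hu, huB⟩)))
      refine not_makerWinsFrom_of_isolated hn (v := c) (fun u hu => ?_) hBS
      rcases mem_union.1 hu with hu | hu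
      · exact hcM u hu
      · have h1 := hT.1 hu
        rw [Finset.mem_sdiff, mk_mem_completeBoard, mem_union] at h1
        exact h1.2 (Or.inl (hBS u (Ne.symm h1.1)))
  | succ j ih =>
    -- Breaker splits his bias evenly among the stars still alive; Maker's reply leaves at least `1
    -- + j * a` of them.
    set q := b / (1 + (j + 1) * a) with hq
    have hU : ∀ c, ∃ U ⊆ missingNbrs B c, U.card = min q (missingNbrs B c).card :=
      fun c => exists_subset_card_eq (min_le_right _ _)
    choose U hU hUc using hU
    refine not_makerWinsFrom_of_move (S₀ := C.biUnion fun c => (U c).image fun u => s(c, u))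
      (fun e he => ?_) ?_ fun S T hS hT => ?_
    · obtain ⟨c, hc, he⟩ := mem_biUnion.1 he
      obtain ⟨u, hu, rfl⟩ := mem_image.1 he
      have hu := mem_missingNbrs.1 (hU c hu)
      simp only [Finset.mem_sdiff, mk_mem_completeBoard, mem_union, not_or]
      exact ⟨hu.1.symm, hu.2, hC.untouched c hc u⟩
    · calc _ ≤ C.card * q := card_biUnion_le_card_mul _ _ _ fun c _ =>
            card_image_le.trans ((hUc c).le.trans (min_le_left _ _))
        _ ≤ b := by rw [hcard, hq]; exact Nat.mul_div_le _ _
    · obtain ⟨C', hC'C, hC'card, hC'⟩ := IsUntouchedClique.exists_after_move (B := B ∪ S)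
        (k := 1 + j * a) hC.untouched
        (fun c hc d hd hcd => mem_union_left _ (hC.clique c hc d hd hcd)) hT
        (by rw [hcard]; exact le_of_eq (by ring))
      refine ih hC' hC'card fun c hc => ?_
      have h1 : missingNbrs (B ∪ S) c ⊆ missingNbrs B c \ U c := fun u hu => by
        refine Finset.mem_sdiff.2 ⟨missingNbrs_subset_of_subset subset_union_left c hu,
          fun huU => (mem_missingNbrs.1 hu).2 (mem_union_right _ (hS ?_))⟩
        exact mem_biUnion.2 ⟨c, hC'C hc, mem_image_of_mem _ huU⟩
      have h2 := card_le_card h1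
      rw [card_sdiff_of_subset (hU c), hUc] at h2
      have h3 := hfree c (hC'C hc)
      rw [sum_range_succ, ← hq] at h3
      omega

theorem card_touched_le (M : Finset (Sym2 (Fin n))) :
    (univ.filter fun v : Fin n => ∃ u, s(v, u) ∈ M).card ≤ 2 * M.card := by
  classical
  refine le_trans ?_ (sum_card_edgeNbrs_le M)
  rw [card_eq_sum_ones, sum_filter]
  refine sum_le_sum fun v _ => ?_
  split_ifs with h
  · obtain ⟨u, hu⟩ := h
    exact card_pos.2 ⟨u, mem_edgeNbrs.2 hu⟩
  · exact Nat.zero_le _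

/-- Breaker builds an untouched clique on `1 + N * a` vertices and then plays the box game. -/
theorem not_makerWinsFrom_of_growing (hn : 2 ≤ n) (N : ℕ) {K : ℕ} (hK : K = 1 + N * a)
    (hb : (a + 1) * (K + a) ≤ b) (hKn : 2 * a * K + K + a + 1 ≤ n)
    (hgain : n - 1 ≤ ∑ i ∈ range (N + 1), b / (1 + i * a)) (r : ℕ)
    {B M : Finset (Sym2 (Fin n))} {C : Finset (Fin n)} (hC : IsUntouchedClique B M C)
    (hr : C.card + r = K) (hM : M.card ≤ a * C.card) :
    ¬ MakerWinsFrom (completeBoard n) (connectedSpanningSets n) a b B M := by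
  classical
  induction r generalizing B M C with
  | zero =>
    exact not_makerWinsFrom_of_untouchedClique hn N hC (by omega) fun c _ =>
      (card_missingNbrs_le B c).trans hgain
  | succ r ih =>
    have hCK : C.card < K := by omega
    -- Joining `a + 1` fresh vertices yields a net gain of one, since Maker destroys at most `a`.
    -- Maker has touched at most `2 * a * C.card` vertices, so `hKn` leaves enough fresh ones.
    have hD : ∃ D ⊆ (univ \ C) \ univ.filter fun v : Fin n => ∃ u, s(v, u) ∈ M,
        D.card = a + 1 := by
      refine exists_subset_card_eq ?_
      have h1 := card_touched_le M
      have h2 := le_card_sdiff (univ.filter fun v : Fin n => ∃ u, s(v, u) ∈ M) (univ \ C)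
      have h3 := card_sdiff_of_subset (subset_univ C)
      rw [card_univ, Fintype.card_fin] at h3
      have h4 : a * C.card ≤ a * K := Nat.mul_le_mul_left _ hCK.le
      rw [mul_assoc] at hKn
      omega
    obtain ⟨D, hD, hDc⟩ := hD
    have hDC : ∀ d ∈ D, d ∉ C := fun d hd => by
      have := hD hd
      simp only [Finset.mem_sdiff] at this
      exact this.1.2
    have hDM : ∀ d ∈ D, ∀ u, s(d, u) ∉ M := fun d hd u hu => by
      have := hD hd
      simp only [Finset.mem_sdiff, mem_filter, not_and, not_exists] at this
      exact this.2 (mem_univ _) u hu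
    have hCD : (C ∪ D).card = C.card + (a + 1) := by
      rw [card_union_of_disjoint, hDc]
      exact Finset.disjoint_right.2 hDC
    have hunt : ∀ c ∈ C ∪ D, ∀ u, s(c, u) ∉ M := fun c hc =>
      (mem_union.1 hc).elim (hC.untouched c) (hDM c)
    let S₀ := ((((C ∪ D) ×ˢ D).filter fun p => p.1 ≠ p.2).image fun p => s(p.1, p.2)) \ B
    refine not_makerWinsFrom_of_move (S₀ := S₀) (fun e he => ?_) ?_ fun S T hS hT => ?_
    · obtain ⟨he, heB⟩ := Finset.mem_sdiff.1 he
      obtain ⟨⟨c, d⟩, hp, rfl⟩ := mem_image.1 he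
      obtain ⟨hp, hne⟩ := mem_filter.1 hp
      simp only [Finset.mem_sdiff, mk_mem_completeBoard, mem_union, not_or]
      exact ⟨hne, heB, hunt c (mem_product.1 hp).1 d⟩
    · -- edges inside `D` are counted twice, which is harmless
      refine (card_le_card sdiff_subset).trans (card_image_le.trans
        ((card_le_card (filter_subset _ _)).trans ?_))
      rw [card_product, hCD, hDc, mul_comm]
      exact (Nat.mul_le_mul_left _ (by omega)).trans hb
    · have hclique : ∀ c ∈ C ∪ D, ∀ d ∈ C ∪ D, c ≠ d → s(c, d) ∈ B ∪ S := by
        have hd : ∀ c ∈ C ∪ D, ∀ d ∈ D, c ≠ d → s(c, d) ∈ B ∪ S := fun c hc d hd hcd => by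
          by_cases h : s(c, d) ∈ B
          · exact mem_union_left _ h
          · exact mem_union_right _ (hS (Finset.mem_sdiff.2 ⟨mem_image.2 ⟨(c, d),
              mem_filter.2 ⟨mem_product.2 ⟨hc, hd⟩, hcd⟩, rfl⟩, h⟩))
        intro c hc d hd' hcd
        rcases mem_union.1 hd' with hdC | hdD
        · rcases mem_union.1 hc with hcC | hcD
          · exact mem_union_left _ (hC.clique c hcC d hdC hcd)
          · rw [Sym2.eq_swap]
            exact hd d hd' c hcD hcd.symm
        · exact hd c hc d hdD hcd
      obtain ⟨C', -, hC'card, hC'⟩ := IsUntouchedClique.exists_after_move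
        (k := C.card + 1) hunt hclique hT (by omega)
      refine ih hC' (by omega) ?_
      rw [hC'card]
      have h1 := card_union_le M T
      have h2 : T.card ≤ a := hT.2.le.trans (min_le_left _ _)
      nlinarith

theorem not_makerWinsFrom_empty_of_gain (hn : 2 ≤ n) (N : ℕ) {K : ℕ} (hK : K = 1 + N * a)
    (hb : (a + 1) * (K + a) ≤ b) (hKn : 2 * a * K + K + a + 1 ≤ n)
    (hgain : n - 1 ≤ ∑ i ∈ range (N + 1), b / (1 + i * a)) :
    ¬ MakerWinsFrom (completeBoard n) (connectedSpanningSets n) a b ∅ ∅ :=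
  not_makerWinsFrom_of_growing hn N hK hb hKn hgain K (C := ∅)
    ⟨fun c hc => by simp at hc, fun c hc => by simp at hc⟩ (by simp) (by simp)

/-- Breaker claims a whole star in his first move. This ensures that the threshold exists. -/
theorem not_makerWinsFrom_empty_of_le (hn : 2 ≤ n) (hb : n - 1 ≤ b) :
    ¬ MakerWinsFrom (completeBoard n) (connectedSpanningSets n) a b ∅ ∅ :=
  not_makerWinsFrom_of_untouchedClique hn 0 (C := {⟨0, by omega⟩})
    ⟨fun c _ u => by simp, fun c hc d hd hcd => (hcd (by simp_all)).elim⟩ (by simp)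
    fun c _ => (card_missingNbrs_le _ c).trans (by simpa using hb)

end BreakerStrategy

/-! ### Asymptotic estimates. -/

section Asymptotics

theorem tendsto_log_natCast : Tendsto (fun n : ℕ => Real.log n) atTop atTop :=
  Real.tendsto_log_atTop.comp tendsto_natCast_atTop_atTop

theorem eventually_log_pow_le (k : ℕ) {c : ℝ} (hc : 0 < c) :
    ∀ᶠ n : ℕ in atTop, Real.log n ^ k ≤ c * n := by
  have h := (Real.isLittleO_pow_log_id_atTop (n := k)).comp_tendsto
    (tendsto_natCast_atTop_atTop (R := ℝ))
  filter_upwards [h.bound hc] with n hn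
  simpa using (le_abs_self _).trans hn

/-- The main terms `b + (b / a) ln n` use at most `(1 - δ) n`. Taking `m` about `δ n / 4` makes both
`Q` terms `O(n / ln n)` for fixed `δ`, so everything fits into the remaining `δ n`, uniformly in `a`
and `b`. -/
theorem eventually_makerWinsFrom {δ : ℝ} (hδ : 0 < δ) (hδ1 : δ < 1) :
    ∀ᶠ n : ℕ in atTop, ∀ a b : ℕ, 1 ≤ a → 1 ≤ b →
      (b : ℝ) ≤ (1 - δ) * (a * n / (a + Real.log n)) →
      MakerWinsFrom (completeBoard n) (connectedSpanningSets n) a b ∅ ∅ := by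
  filter_upwards [eventually_ge_atTop 1,
    tendsto_natCast_atTop_atTop.eventually_ge_atTop (4 * (8 / δ + 3) / δ),
    tendsto_log_natCast.eventually_ge_atTop (4 * (8 / δ + 2) / δ),
    tendsto_log_natCast.eventually_ge_atTop 1] with n hn1 hn hL hL1 a b ha hb hab
  set L := Real.log n
  have hn0 : (0 : ℝ) < n := by exact_mod_cast hn1
  have ha0 : (0 : ℝ) < a := by exact_mod_cast ha
  have hL0 : 0 < L := by linarith
  have hmpos : 0 < ⌈δ * n / 4⌉₊ := Nat.ceil_pos.2 (by positivity)
  have hm1 : δ * n / 4 ≤ (⌈δ * n / 4⌉₊ : ℝ) := Nat.le_ceil _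
  have hm2 : (⌈δ * n / 4⌉₊ : ℝ) < δ * n / 4 + 1 := Nat.ceil_lt_add_one (by positivity)
  refine makerWinsFrom_empty hn1 ha hb hmpos rfl ?_
  set m : ℝ := (⌈δ * n / 4⌉₊ : ℝ)
  have hbn : (b : ℝ) / a * (a + L) ≤ (1 - δ) * n := by
    have h := mul_le_mul_of_nonneg_right hab (by positivity : 0 ≤ (a + L) / a)
    calc (b : ℝ) / a * (a + L) = b * ((a + L) / a) := by ring
      _ ≤ (1 - δ) * (a * n / (a + L)) * ((a + L) / a) := h
      _ = (1 - δ) * n := by field_simp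
  have hsplit : (b : ℝ) / a * (a + L) = b + b / a * L := by field_simp
  have hba : 0 ≤ (b : ℝ) / a := by positivity
  have hba1 : (b : ℝ) / a ≤ n / L := by
    rw [le_div_iff₀ hL0]
    nlinarith [mul_nonneg hba hL0.le, mul_pos hδ hn0, mul_nonneg hba ha0.le]
  have hble : (b : ℝ) ≤ n := by nlinarith [mul_nonneg hba hL0.le, mul_pos hδ hn0]
  have hQ : (b : ℝ) * (n / a + 1) ≤ n * (n / L + 1) := by
    calc (b : ℝ) * (n / a + 1) = n * (b / a) + b := by field_simp
      _ ≤ n * (n / L) + n := by gcongr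
      _ = _ := by ring
  have h1 : 2 * ((b : ℝ) * (n / a + 1)) / m ≤ 8 / δ * (n / L + 1) := by
    calc 2 * ((b : ℝ) * (n / a + 1)) / m ≤ 2 * (n * (n / L + 1)) / (δ * n / 4) := by gcongr
      _ = _ := by field_simp; ring
  have h2 : 2 * ((b : ℝ) * (n / a + 1)) / n ≤ 2 * (n / L + 1) := by
    calc 2 * ((b : ℝ) * (n / a + 1)) / n ≤ 2 * (n * (n / L + 1)) / n := by gcongr
      _ = _ := by field_simp
  have h3 : (8 / δ + 2) * (n / L) ≤ δ * n / 4 := by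
    rw [div_le_iff₀ hδ] at hL
    rw [mul_div_assoc', div_le_iff₀ hL0]
    nlinarith
  have h4 : 8 / δ + 3 ≤ δ * n / 4 := by
    rw [div_le_iff₀ hδ] at hn
    linarith
  nlinarith [mul_pos hδ hn0]

/-- Harmonic sum by induction, using `1 + i * a ≤ a * (i + 1)`. The term `i = 0` is exact; each of
the other `N` floors loses at most one. -/
theorem le_sum_div {a : ℕ} (ha : 1 ≤ a) (b N : ℕ) :
    (b : ℝ) + b / a * (Real.log (N + 2) - 1) - N ≤
      ((∑ i ∈ Finset.range (N + 1), b / (1 + i * a) : ℕ) : ℝ) := by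
  have ha0 : (0 : ℝ) < a := by exact_mod_cast ha
  induction N with
  | zero =>
    have h1 : Real.log 2 ≤ 1 := by linarith [Real.log_two_lt_d9]
    have h2 : (b : ℝ) / a * (Real.log 2 - 1) ≤ 0 :=
      mul_nonpos_of_nonneg_of_nonpos (by positivity) (by linarith)
    simp
    linarith
  | succ N ih =>
    rw [Finset.sum_range_succ, Nat.cast_add]
    have h1 : (b : ℝ) / (a * (N + 2)) - 1 ≤ ((b / (1 + (N + 1) * a) : ℕ) : ℝ) := by
      have h2 : (b : ℝ) / ((1 + (N + 1) * a : ℕ) : ℝ) - 1 < ((b / (1 + (N + 1) * a) : ℕ) : ℝ) := by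
        rw [← Nat.floor_div_eq_div (K := ℝ)]
        exact Nat.sub_one_lt_floor _
      have h3 : (b : ℝ) / (a * (N + 2)) ≤ (b : ℝ) / ((1 + (N + 1) * a : ℕ) : ℝ) := by
        refine div_le_div_of_nonneg_left (by positivity) (by positivity) ?_
        have : (1 : ℝ) ≤ a := by exact_mod_cast ha
        push_cast
        linarith
      linarith
    have h4 : Real.log ((N + 1 : ℕ) + 2) ≤ Real.log (N + 2) + 1 / (N + 2) := by
      have h5 : (((N + 1 : ℕ) : ℝ) + 2) = (N + 2) * (1 + 1 / (N + 2)) := by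
        push_cast
        field_simp
        ring
      rw [h5, Real.log_mul (by positivity) (by positivity)]
      linarith [Real.log_le_sub_one_of_pos (by positivity : (0 : ℝ) < 1 + 1 / (N + 2))]
    have h6 := mul_le_mul_of_nonneg_left h4 (by positivity : 0 ≤ (b : ℝ) / a)
    have h7 : (b : ℝ) / (a * (N + 2)) = b / a * (1 / (N + 2)) := by field_simp
    push_cast at *
    nlinarith

theorem le_sum_div_of_log {a b N : ℕ} {n L δ : ℝ} (ha : 1 ≤ a) (hn0 : 0 < n) (hδ : 0 < δ)
    (hδ1 : δ < 1) (hL1 : 1 ≤ L) (hL8 : 8 / δ ≤ L) (hlog : 5 * Real.log L + 1 ≤ δ / 8 * L)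
    (hlogN : L - 5 * Real.log L ≤ Real.log (N + 2)) (hN : (N : ℝ) ≤ n / L ^ 5)
    (hbaL : (1 + δ) * n ≤ b / a * (a + L)) :
    n ≤ ((∑ i ∈ Finset.range (N + 1), b / (1 + i * a) : ℕ) : ℝ) := by
  have ha0 : (0 : ℝ) < a := by exact_mod_cast ha
  refine le_trans ?_ (le_sum_div ha b N)
  have hba : 0 ≤ (b : ℝ) / a := by positivity
  have h1 : (b : ℝ) / a * (L - δ / 8 * L) ≤ b / a * (Real.log (N + 2) - 1) :=
    mul_le_mul_of_nonneg_left (by linarith) hba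
  have h2 : (b : ℝ) + b / a * (L - δ / 8 * L) = b / a * (a + L) - δ / 8 * (b / a * L) := by
    field_simp
    ring
  have h3 : (n : ℝ) / L ^ 5 ≤ δ / 8 * n := by
    rw [div_le_iff₀ hδ] at hL8
    rw [div_le_iff₀ (by positivity)]
    have h4 : L ≤ L ^ 5 := le_self_pow₀ hL1 (by norm_num)
    have h5 : 1 ≤ δ / 8 * L ^ 5 := by
      have := mul_le_mul_of_nonneg_left h4 hδ.le
      linarith
    calc n = 1 * n := (one_mul n).symm
      _ ≤ δ / 8 * L ^ 5 * n := mul_le_mul_of_nonneg_right h5 hn0.le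
      _ = _ := by ring
  have h4 : (1 - δ / 8) * (b / a * (a + L)) ≤ b / a * (a + L) - δ / 8 * (b / a * L) := by
    nlinarith [mul_nonneg hδ.le (mul_nonneg hba ha0.le)]
  have h5 := mul_le_mul_of_nonneg_left hbaL (by linarith : 0 ≤ 1 - δ / 8)
  have h6 : (n : ℝ) + δ / 8 * n ≤ (1 - δ / 8) * ((1 + δ) * n) := by
    have := mul_pos hδ hn0
    have := mul_pos this (sub_pos.2 hδ1)
    linarith
  linarith

/-- Unless `b ≥ n - 1`, where one star suffices, the hypothesis on `b` forces `a ≤ (ln n) / δ`. For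
such `a` the clique is cheap to build. -/
theorem eventually_not_makerWinsFrom {δ : ℝ} (hδ : 0 < δ) (hδ1 : δ < 1) :
    ∀ᶠ n : ℕ in atTop, ∀ a b : ℕ, 1 ≤ a →
      (1 + δ) * (a * n / (a + Real.log n)) ≤ (b : ℝ) →
      ¬ MakerWinsFrom (completeBoard n) (connectedSpanningSets n) a b ∅ ∅ := by
  have hlog : ∀ᶠ n : ℕ in atTop, 5 * Real.log (Real.log n) + 1 ≤ δ / 8 * Real.log n := by
    have h1 := Real.isLittleO_log_id_atTop.bound (by positivity : 0 < δ / 80)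
    filter_upwards [tendsto_log_natCast.eventually h1,
      tendsto_log_natCast.eventually_ge_atTop (16 / δ)] with n hn hn2
    have h2 : 0 < Real.log n := lt_of_lt_of_le (by positivity) hn2
    rw [id, Real.norm_eq_abs, Real.norm_eq_abs, abs_of_pos h2] at hn
    rw [div_le_iff₀ hδ] at hn2
    linarith [le_abs_self (Real.log (Real.log n))]
  filter_upwards [eventually_ge_atTop 2, hlog, tendsto_log_natCast.eventually_ge_atTop 1,
    tendsto_log_natCast.eventually_ge_atTop (12 / δ ^ 2),
    tendsto_log_natCast.eventually_ge_atTop (8 / δ), eventually_log_pow_le 5 one_pos]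
    with n hn2 hlog hL1 hL12 hL8 hL5 a b ha hab
  by_cases hbn : n - 1 ≤ b
  · exact not_makerWinsFrom_empty_of_le hn2 hbn
  set L := Real.log n with hLdef
  have hL0 : 0 < L := by linarith
  have hn0 : (0 : ℝ) < n := by exact_mod_cast (by omega : 0 < n)
  have ha1 : (1 : ℝ) ≤ a := by exact_mod_cast ha
  have ha0 : (0 : ℝ) < a := by linarith
  have hbn' : (b : ℝ) < n := by exact_mod_cast (by omega : b < n)
  have hbaL : (1 + δ) * n ≤ b / a * (a + L) := by
    have h := mul_le_mul_of_nonneg_right hab (by positivity : 0 ≤ (a + L) / a)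
    calc (1 + δ) * n = (1 + δ) * (a * n / (a + L)) * ((a + L) / a) := by field_simp
      _ ≤ b * ((a + L) / a) := h
      _ = _ := by ring
  have haL : a ≤ L / δ := by
    rw [le_div_iff₀ hδ]
    have h1 : (b : ℝ) / a * (a + L) < n / a * (a + L) := by gcongr
    have h2 : (1 + δ) * n < n / a * (a + L) := hbaL.trans_lt h1
    have h3 : n / a * (a + L) = n * ((a + L) / a) := by ring
    rw [h3, mul_comm] at h2
    have h4 := lt_of_mul_lt_mul_left h2 hn0.le
    rw [lt_div_iff₀ ha0] at h4
    linarith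
  have hb2L : (n : ℝ) / (2 * L) ≤ b := by
    refine le_trans ?_ hab
    have h1 : (n : ℝ) / (2 * L) ≤ a * n / (a + L) := by
      rw [div_le_div_iff₀ (by positivity) (by positivity)]
      have : (a : ℝ) + L ≤ a * (2 * L) := by nlinarith
      nlinarith [mul_le_mul_of_nonneg_left this hn0.le]
    have h2 : 0 ≤ (a : ℝ) * n / (a + L) := by positivity
    nlinarith
  have hnL : 1 ≤ (n : ℝ) / L ^ 5 := by
    rw [le_div_iff₀ (by positivity)]
    linarith
  -- Large enough that `ln N` is `(1 - o(1)) L`, small enough that building the clique, costing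
  -- `O(a² N) = O(n / L³)` per round, fits into `b ≥ n / (2L)`.
  set N := ⌊(n : ℝ) / L ^ 5⌋₊ with hN
  have hN1 : (N : ℝ) ≤ n / L ^ 5 := Nat.floor_le (by positivity)
  have hN2 : (n : ℝ) / L ^ 5 < N + 1 := Nat.lt_floor_add_one _
  have hprod : ((a : ℝ) + 1) * (1 + N * a + a) ≤ 6 * n / (δ ^ 2 * L ^ 3) := by
    calc ((a : ℝ) + 1) * (1 + N * a + a)
        ≤ (2 * a) * (n / L ^ 5 * a + n / L ^ 5 * a + n / L ^ 5 * a) := by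
          gcongr
          · linarith
          · nlinarith
          · nlinarith
      _ = 6 * (n / L ^ 5) * (a * a) := by ring
      _ ≤ 6 * (n / L ^ 5) * (L / δ * (L / δ)) := by gcongr
      _ = 6 * n / (δ ^ 2 * L ^ 3) := by field_simp
  have hsmall : 6 * (n : ℝ) / (δ ^ 2 * L ^ 3) ≤ n / (2 * L) := by
    rw [div_le_iff₀ (by positivity)] at hL12
    rw [div_le_div_iff₀ (by positivity) (by positivity)]
    have h1 : 12 ≤ L ^ 2 * δ ^ 2 := by nlinarith [pow_pos hδ 2]
    nlinarith [mul_le_mul_of_nonneg_left h1 (by positivity : 0 ≤ n * L)]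
  have hhalf : (n : ℝ) / (2 * L) ≤ n / 2 := by
    gcongr
    linarith
  have hKb : (a + 1) * (1 + N * a + a) ≤ b := by
    have : ((a : ℝ) + 1) * (1 + N * a + a) ≤ b := by linarith
    exact_mod_cast this
  have hKn : 2 * ((a + 1) * (1 + N * a + a)) ≤ n := by
    have : 2 * (((a : ℝ) + 1) * (1 + N * a + a)) ≤ n := by linarith
    exact_mod_cast this
  refine not_makerWinsFrom_empty_of_gain hn2 N rfl hKb (by nlinarith) ?_
  suffices h : (n : ℝ) ≤ ((∑ i ∈ Finset.range (N + 1), b / (1 + i * a) : ℕ) : ℝ) from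
    (Nat.sub_le n 1).trans (by exact_mod_cast h)
  have hlogN : L - 5 * Real.log L ≤ Real.log (N + 2) := by
    have h1 : Real.log (n / L ^ 5) = L - 5 * Real.log L := by
      rw [Real.log_div hn0.ne' (by positivity), Real.log_pow]
      push_cast
      ring
    rw [← h1]
    exact Real.log_le_log (by positivity) (by linarith)
  exact le_sum_div_of_log ha hn0 hδ hδ1 hL1 hL8 hlog hlogN hN1 hbaL

theorem isAsymptoticConnectivityBias (a : ℕ → ℕ) (ha : ∀ᶠ n in atTop, 1 ≤ a n) :
    IsAsymptoticConnectivityBias a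
      (fun n => (a n : ℝ) * n / ((a n : ℝ) + Real.log n)) := by
  have hex : ∀ n : ℕ, ∃ b₀, 2 ≤ n →
      IsThresholdBias (completeBoard n) (connectedSpanningSets n) (a n) b₀ ∧
      ¬ MakerWinsFrom (completeBoard n) (connectedSpanningSets n) (a n) b₀ ∅ ∅ ∧
      ∀ b, 1 ≤ b → b < b₀ →
        MakerWinsFrom (completeBoard n) (connectedSpanningSets n) (a n) b ∅ ∅ := by
    intro n
    by_cases hn : 2 ≤ n
    · obtain ⟨b₀, h⟩ := exists_isThresholdBias
        ⟨n - 1, by omega, not_makerWinsFrom_empty_of_le (a := a n) hn le_rfl⟩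
      exact ⟨b₀, fun _ => h⟩
    · exact ⟨0, fun h => (hn h).elim⟩
  choose b₀ hb₀ using hex
  refine ⟨b₀, (eventually_ge_atTop 2).mono fun n hn => (hb₀ n hn).1, ?_⟩
  rw [IsEquivalent, isLittleO_iff]
  intro c hc
  set δ := min c 1 / 2 with hδdef
  have hδ : 0 < δ := by positivity
  have hδ1 : δ < 1 := by
    have := min_le_right c 1
    linarith
  have hδc : 2 * δ ≤ c := by
    have := min_le_left c 1
    linarith
  filter_upwards [ha, eventually_ge_atTop 2, eventually_makerWinsFrom hδ hδ1,
    eventually_not_makerWinsFrom hδ hδ1, tendsto_log_natCast.eventually_ge_atTop 1,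
    eventually_log_pow_le 2 (half_pos hδ), tendsto_log_natCast.eventually_ge_atTop (1 / δ)]
    with n han hn hmaker hbreaker hL1 hL2 hLδ
  obtain ⟨hthr, hnot, hlt⟩ := hb₀ n hn
  set L := Real.log n
  have hL0 : 0 < L := by linarith
  have hn0 : (0 : ℝ) < n := by exact_mod_cast (by omega : 0 < n)
  have ha1 : (1 : ℝ) ≤ a n := by exact_mod_cast han
  set f := (a n : ℝ) * n / (a n + L)
  have hf : (n : ℝ) / (2 * L) ≤ f := by
    rw [div_le_div_iff₀ (by positivity) (by positivity)]
    have : (a n : ℝ) + L ≤ a n * (2 * L) := by nlinarith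
    nlinarith [mul_le_mul_of_nonneg_left this hn0.le]
  have hf0 : 0 < f := lt_of_lt_of_le (by positivity) hf
  -- Absorbs the off-by-one from testing Maker's win at `b₀ - 1`.
  have hδf : 1 ≤ δ * f := by
    have h1 : 1 ≤ δ * (n / (2 * L)) := by
      rw [mul_div_assoc', le_div_iff₀ (by positivity)]
      nlinarith
    exact h1.trans (mul_le_mul_of_nonneg_left hf hδ.le)
  have hlow : (1 - δ) * f < b₀ n := by
    by_contra! h
    exact hnot (hmaker _ _ han hthr.1 h)
  have hup : (b₀ n : ℝ) ≤ (1 + δ) * f + 1 := by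
    by_contra! h
    have h2 : 1 < b₀ n := by
      have : (1 : ℝ) < b₀ n := by nlinarith
      exact_mod_cast this
    refine hbreaker (a n) (b₀ n - 1) han ?_ (hlt _ (by omega) (by omega))
    rw [Nat.cast_sub h2.le]
    push_cast
    linarith
  simp only [Pi.sub_apply]
  rw [Real.norm_eq_abs, Real.norm_eq_abs, abs_of_pos hf0, abs_le]
  have := mul_le_mul_of_nonneg_right hδc hf0.le
  constructor <;> nlinarith

end Asymptotics

theorem mainTheorem5 (a : ℕ → ℕ) (ha : ∀ᶠ n in atTop, 1 ≤ a n) :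
    ((fun n => (a n : ℝ)) =o[atTop] (fun n : ℕ => √((n : ℝ) / Real.log n)) →
      IsAsymptoticConnectivityBias a
        (fun n => (a n : ℝ) * n / ((a n : ℝ) + Real.log n))) ∧
    ((fun n : ℕ => √((n : ℝ) / Real.log n)) =O[atTop] (fun n => (a n : ℝ)) →
      IsAsymptoticConnectivityBias a (fun n => (n : ℝ))) ∧
    (∀ c : ℝ, 0 < c →
      (fun n => (a n : ℝ)) ~[atTop] (fun n : ℕ => c * Real.log n) →
      IsAsymptoticConnectivityBias a (fun n => c * n / (c + 1))) := by
  obtain ⟨b₀, hb₀, hequiv⟩ := isAsymptoticConnectivityBias a ha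
  refine ⟨fun _ => ⟨b₀, hb₀, hequiv⟩, fun hO => ⟨b₀, hb₀, hequiv.trans ?_⟩,
    fun c hc hac => ⟨b₀, hb₀, hequiv.trans ?_⟩⟩
  -- Thus `ln n = o(a)`, and `a / (a + ln n)` tends to one.
  · have hlog : (fun n : ℕ => Real.log n) =o[atTop] (fun n : ℕ => √((n : ℝ) / Real.log n)) := by
      rw [isLittleO_iff]
      intro c hc
      filter_upwards [eventually_log_pow_le 3 (pow_pos hc 2),
        tendsto_log_natCast.eventually_ge_atTop 1] with n hn hL
      rw [Real.norm_eq_abs, Real.norm_eq_abs, abs_of_nonneg (by linarith),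
        abs_of_nonneg (Real.sqrt_nonneg _), ← div_le_iff₀' hc]
      refine Real.le_sqrt_of_sq_le ?_
      rw [div_pow, div_le_div_iff₀ (by positivity) (by linarith)]
      nlinarith
    rw [IsEquivalent, isLittleO_iff]
    intro c hc
    filter_upwards [(hlog.trans_isBigO hO).bound hc, ha,
      tendsto_log_natCast.eventually_ge_atTop 1] with n hn han hL
    have ha1 : (1 : ℝ) ≤ a n := by exact_mod_cast han
    have hn0 : (0 : ℝ) ≤ n := Nat.cast_nonneg n
    rw [Real.norm_eq_abs, Real.norm_eq_abs, abs_of_nonneg (by linarith),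
      abs_of_nonneg (by linarith)] at hn
    have h1 : (a n : ℝ) * n / (a n + Real.log n) - n =
        -(n * (Real.log n / (a n + Real.log n))) := by
      have : (a n : ℝ) + Real.log n ≠ 0 := by linarith
      field_simp
      ring
    have h2 : Real.log n / (a n + Real.log n) ≤ c := by
      rw [div_le_iff₀ (by linarith)]
      nlinarith
    simp only [Pi.sub_apply]
    rw [h1, norm_neg, Real.norm_eq_abs, Real.norm_eq_abs, abs_of_nonneg hn0,
      abs_of_nonneg (by positivity), mul_comm]
    exact mul_le_mul_of_nonneg_right h2 hn0
  · have hlim : Tendsto (fun n : ℕ => (a n : ℝ) / (a n + Real.log n)) atTop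
        (nhds (c / (c + 1))) := by
      have h1 := (isEquivalent_iff_tendsto_one ((tendsto_log_natCast.eventually_gt_atTop 0).mono
        fun n hn => (mul_pos hc hn).ne')).1 hac
      have h2 := (h1.const_mul c).div ((h1.const_mul c).add_const 1) (by linarith)
      rw [mul_one] at h2
      refine h2.congr' ?_
      filter_upwards [tendsto_log_natCast.eventually_gt_atTop 0] with n hn
      have h3 : (a n : ℝ) + Real.log n ≠ 0 := by positivity
      simp only [Pi.div_apply]
      field_simp
    have h4 : (fun n : ℕ => (a n : ℝ) / (a n + Real.log n)) ~[atTop] fun _ => c / (c + 1) :=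
      (isEquivalent_const_iff_tendsto (by positivity)).2 hlim
    have h5 := h4.mul (IsEquivalent.refl (u := fun n : ℕ => (n : ℝ)))
    refine (h5.congr_left ?_).congr_right ?_
    · exact Eventually.of_forall fun n => by simp only [Pi.mul_apply]; ring
    · exact Eventually.of_forall fun n => by simp only [Pi.mul_apply]; ring
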